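/- Let $c_1=4k_1^4\approx 125.14$, where $k_1\approx 2.36502$ is the smallest positive solution of $\tan k=-\tanh k$. Let $M,N\in\mathbb R$ with $0<M<c_1$, and let $k:[0,1]\times[0,1]\to\mathbb R$ be continuous with $N\,k(x,t)\ge 0$ for all $x,t\in[0,1]$. Let $G$ be the Green function of $$y^{(4)}(x)+My(x)=0,\quad x\in(0,1),\qquad y(0)=y(1)=y''(0)=y''(1)=0,$$ that is, with $m\in\mathbb C$ such that $m^4=-M$, $$G(x,s)=\frac1{2m^2}\left[\frac{\sin(mx)\sin(m(1-s))}{m\sin m}-\frac{\sinh(mx)\sinh(m(1-s))}{m\sinh m}\right]\quad(0\le x\le s\le1),\qquad G(x,s)=G(s,x)\quad(0\le s\le x\le 1).$$ Put $\|k\|_\infty=\max_{(x,t)\in[0,1]^2}|k(x,t)|$ and assume that $$\|k\|_\infty<\frac{1}{|N|\,\max_{x\in[0,1]}\int_0^1G(x,s)\,ds}$$ (no restriction if $N=0$). Then for every $p\in C[0,1]$ and all $A,B,C,D\in\mathbb R$ the problem $$y^{(4)}(x)+My(x)-N\int_0^1k(x,t)y(t)\,dt=p(x),\quad x\in(0,1),\qquad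 y(0)=A,\ y(1)=B,\ y''(0)=C,\ y''(1)=D,$$ has a unique solution $y\in C^4[0,1]$, and: (i) if $p\ge0$ on $[0,1]$, $A,B\ge0$ and $C,D\le0$, then $y\ge0$ on $[0,1]$; (ii) if $p\le0$ on $[0,1]$, $A,B\le0$ and $C,D\ge0$, then $y\le0$ on $[0,1]$. In particular, for the homogeneous boundary conditions $y(0)=y(1)=y''(0)=y''(1)=0$, the unique solution satisfies $y\ge0$ if $p\ge0$, and $y\le0$ if $p\le0$. -/

import Mathlib

namespace NavierBVP

open Set

noncomputable section

/-- `y` is a classical solution, of class `C⁴` on `[0,1]`, of the nonlocal problem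
`y⁽⁴⁾(x) + M y(x) - N ∫₀¹ k(x,t) y(t) dt = p(x)` for `0 < x < 1`, with
`y(0) = A`, `y(1) = B`, `y''(0) = C`, `y''(1) = D`.
All derivatives are derivatives relative to `[0,1]`, hence one-sided at the end points. -/
structure IsSolution (M N : ℝ) (k : ℝ → ℝ → ℝ) (p : ℝ → ℝ) (A B C D : ℝ) (y : ℝ → ℝ) :
    Prop where
  contDiffOn : ContDiffOn ℝ 4 y (Icc 0 1)
  equation : ∀ x ∈ Ioo (0 : ℝ) 1,
    iteratedDerivWithin 4 y (Icc 0 1) x + M * y x - N * ∫ t in (0 : ℝ)..1, k x t * y t = p x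
  left : y 0 = A
  right : y 1 = B
  left₂ : iteratedDerivWithin 2 y (Icc 0 1) 0 = C
  right₂ : iteratedDerivWithin 2 y (Icc 0 1) 1 = D

/-- The problem with given data has a solution, and only one as a function on `[0,1]`. -/
def HasUniqueSolution (M N : ℝ) (k : ℝ → ℝ → ℝ) (p : ℝ → ℝ) (A B C D : ℝ) : Prop :=
  ∃ y, IsSolution M N k p A B C D y ∧ ∀ z, IsSolution M N k p A B C D z → EqOn z y (Icc 0 1)

/-- A complex number with `m ^ 4 = -M` (for `M ≥ 0`). -/
def root (M : ℝ) : ℂ := (√(√(M / 4)) : ℝ) * (1 + Complex.I)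

/-- The expression
`(1 / 2m²) (sin(mu) sin(mv) / (m sin m) - sinh(mu) sinh(mv) / (m sinh m))`. -/
def kernel (m u v : ℂ) : ℂ :=
  1 / (2 * m ^ 2) *
    (Complex.sin (m * u) * Complex.sin (m * v) / (m * Complex.sin m) -
      Complex.sinh (m * u) * Complex.sinh (m * v) / (m * Complex.sinh m))

/-- The Green function of `y⁽⁴⁾ + M y`, `M > 0`, with the boundary conditions
`y(0) = y(1) = y''(0) = y''(1) = 0`. With `m ^ 4 = -M` the kernel is real (its two terms are
complex conjugate to each other), so that the real part only changes the type. -/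
def green (M x s : ℝ) : ℝ :=
  if x ≤ s then (kernel (root M) x (1 - s)).re else (kernel (root M) s (1 - x)).re

/-- `max_{0 ≤ x ≤ 1} ∫₀¹ G(x,s) ds`. -/
def greenMax (M : ℝ) : ℝ := sSup ((fun x => ∫ s in (0 : ℝ)..1, green M x s) '' Icc 0 1)

/-- The maximum norm `‖k‖_∞ = max |k(x,t)|` over the unit square. -/
def supNorm (k : ℝ → ℝ → ℝ) : ℝ :=
  sSup ((fun q : ℝ × ℝ => |k q.1 q.2|) '' (Icc 0 1 ×ˢ Icc 0 1))

/-- The smallest positive solution `k₁ ≈ 2.36502` of `tan k = - tanh k`. -/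
def k₁ : ℝ := sInf {κ : ℝ | 0 < κ ∧ Real.tan κ = -Real.tanh κ}

/-- The constant `c₁ = 4 k₁⁴ ≈ 125.14`. -/
def c₁ : ℝ := 4 * k₁ ^ 4

section GreenFunction

open intervalIntegral

theorem root_pow_four {M : ℝ} (hM : 0 ≤ M) : root M ^ 4 = -(M : ℂ) := by
  have h1 : (√(√(M / 4))) ^ 4 = M / 4 := by
    rw [show (4 : ℕ) = 2 * 2 from rfl, pow_mul, Real.sq_sqrt (Real.sqrt_nonneg _),
      Real.sq_sqrt (by positivity)]
  have h2 : (1 + Complex.I) ^ 4 = -4 := by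
    have h : (1 + Complex.I) ^ 2 = 2 * Complex.I := by
      linear_combination Complex.I_sq
    rw [show (4 : ℕ) = 2 * 2 from rfl, pow_mul, h]
    linear_combination 4 * Complex.I_sq
  rw [root, mul_pow, h2, ← Complex.ofReal_pow, h1]
  push_cast
  ring

theorem sin_root_ne {M : ℝ} (hM : 0 < M) :
    Complex.sin (root M) ≠ 0 ∧ Complex.sinh (root M) ≠ 0 := by
  have ha : 0 < √(√(M / 4)) := by positivity
  have hre : (root M).re = √(√(M / 4)) := by simp [root]
  have him : (root M).im = √(√(M / 4)) := by simp [root]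
  constructor
  · rw [Complex.sin_ne_zero_iff]
    intro n h
    have := congrArg Complex.im h
    rw [him] at this
    simp only [Complex.mul_im, Complex.intCast_re, Complex.ofReal_im, Complex.intCast_im,
      mul_zero, zero_mul, add_zero] at this
    linarith
  · intro h
    have h2 : Complex.sin (root M * Complex.I) = 0 := by
      rw [Complex.sin_mul_I, h, zero_mul]
    rw [Complex.sin_eq_zero_iff] at h2
    obtain ⟨n, h2⟩ := h2
    have := congrArg Complex.im h2
    simp only [Complex.mul_im, Complex.I_im, Complex.I_re, hre, Complex.intCast_re,
      Complex.ofReal_im, Complex.intCast_im, mul_zero, zero_mul, add_zero, mul_one] at this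
    linarith

/-- Two derivatives of a Green potential with the separated kernel `f(min) f(1 - max)`. -/
theorem hasDerivAt_potential {f g : ℝ → ℂ} {l : ℂ} {q : ℝ → ℂ}
    (hf : ∀ x, HasDerivAt f (g x) x) (hg : ∀ x, HasDerivAt g (l * f x) x)
    (hq : Continuous q) (x : ℝ) :
    HasDerivAt (fun x => f (1 - x) * (∫ s in (0 : ℝ)..x, f s * q s) +
        f x * ∫ s in x..1, f (1 - s) * q s)
      (-g (1 - x) * (∫ s in (0 : ℝ)..x, f s * q s) +
        g x * ∫ s in x..1, f (1 - s) * q s) x ∧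
    HasDerivAt (fun x => -g (1 - x) * (∫ s in (0 : ℝ)..x, f s * q s) +
        g x * ∫ s in x..1, f (1 - s) * q s)
      (l * (f (1 - x) * (∫ s in (0 : ℝ)..x, f s * q s) +
        f x * ∫ s in x..1, f (1 - s) * q s) -
        (g (1 - x) * f x + g x * f (1 - x)) * q x) x := by
  have hfc : Continuous f := continuous_iff_continuousAt.2 fun x => (hf x).continuousAt
  have c1 : Continuous fun s => f s * q s := hfc.mul hq
  have c2 : Continuous fun s => f (1 - s) * q s :=
    (hfc.comp (continuous_const.sub continuous_id)).mul hq
  have d1 : HasDerivAt (fun x => ∫ s in (0 : ℝ)..x, f s * q s) (f x * q x) x :=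
    integral_hasDerivAt_right (c1.intervalIntegrable _ _)
      (c1.stronglyMeasurableAtFilter _ _) c1.continuousAt
  have d2 : HasDerivAt (fun x => ∫ s in x..1, f (1 - s) * q s) (-(f (1 - x) * q x)) x :=
    integral_hasDerivAt_left (c2.intervalIntegrable _ _)
      (c2.stronglyMeasurableAtFilter _ _) c2.continuousAt
  have r1 : HasDerivAt (fun x => f (1 - x)) (-g (1 - x)) x := by
    have := (hf (1 - x)).scomp x ((hasDerivAt_id x).const_sub 1)
    simpa [Function.comp_def] using this
  have r2 : HasDerivAt (fun x => -g (1 - x)) (l * f (1 - x)) x := by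
    have := ((hg (1 - x)).scomp x ((hasDerivAt_id x).const_sub 1)).neg
    simpa [Function.comp_def, Pi.neg_def] using this
  constructor
  · exact ((r1.mul d1).add ((hf x).mul d2)).congr_deriv (by ring)
  · exact ((r2.mul d1).add ((hg x).mul d2)).congr_deriv (by ring)

/-- The function `green M` is the Green function: for every continuous `p`, the function
`x ↦ ∫₀¹ G(x,s) p(s) ds` solves `y⁽⁴⁾ + M y = p` with homogeneous boundary conditions. -/
theorem isSolution_green {M : ℝ} (hM : 0 < M) {p : ℝ → ℝ} (hp : ContinuousOn p (Icc 0 1)) :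
    IsSolution M 0 (fun _ _ => 0) p 0 0 0 0 (fun x => ∫ s in (0 : ℝ)..1, green M x s * p s) := by
  set m := root M with hm
  have hm4 : m ^ 4 = -(M : ℂ) := root_pow_four hM.le
  obtain ⟨hs, hsh⟩ := sin_root_ne hM
  rw [← hm] at hs hsh
  have hm0 : m ≠ 0 := by
    rintro h
    rw [h] at hs
    simp at hs
  obtain ⟨P, hP, hPp⟩ : ∃ P : ℝ → ℝ, Continuous P ∧ ∀ x ∈ Icc (0 : ℝ) 1, P x = p x :=
    ⟨IccExtend zero_le_one ((Icc 0 1).domRestrict p),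
      (continuousOn_iff_continuous_domRestrict.1 hp).Icc_extend',
      fun x hx => by rw [IccExtend_of_mem _ _ hx]; rfl⟩
  set q : ℝ → ℂ := fun x => (P x : ℂ) with hq
  have hqc : Continuous q := Complex.continuous_ofReal.comp hP
  -- the two building blocks
  set S : ℝ → ℂ := fun x => Complex.sin (m * x) with hS
  set S' : ℝ → ℂ := fun x => m * Complex.cos (m * x) with hS'
  set H : ℝ → ℂ := fun x => Complex.sinh (m * x) with hH
  set H' : ℝ → ℂ := fun x => m * Complex.cosh (m * x) with hH'
  have lin (x : ℝ) : HasDerivAt (fun x : ℝ => m * (x : ℂ)) m x := by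
    simpa using (Complex.ofRealCLM.hasDerivAt (x := x)).const_mul m
  have dS (x : ℝ) : HasDerivAt S (S' x) x := by
    exact ((Complex.hasDerivAt_sin (m * x)).comp x (lin x)).congr_deriv (by change _ = m * Complex.cos (m * x); ring)
  have dS' (x : ℝ) : HasDerivAt S' (-m ^ 2 * S x) x := by
    exact (((Complex.hasDerivAt_cos (m * x)).comp x (lin x)).const_mul m).congr_deriv (by change _ = -m ^ 2 * Complex.sin (m * x); ring)
  have dH (x : ℝ) : HasDerivAt H (H' x) x := by
    exact ((Complex.hasDerivAt_sinh (m * x)).comp x (lin x)).congr_deriv (by change _ = m * Complex.cosh (m * x); ring)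
  have dH' (x : ℝ) : HasDerivAt H' (m ^ 2 * H x) x := by
    exact (((Complex.hasDerivAt_cosh (m * x)).comp x (lin x)).const_mul m).congr_deriv (by change _ = m ^ 2 * Complex.sinh (m * x); ring)
  have wS (x : ℝ) : S' (1 - x) * S x + S' x * S (1 - x) = m * Complex.sin m := by
    have : m = m * ((1 - x : ℝ) : ℂ) + m * x := by push_cast; ring
    simp only [hS, hS']
    conv_rhs => rw [show Complex.sin m = Complex.sin (m * ((1 - x : ℝ) : ℂ) + m * x) by
      rw [← this], Complex.sin_add]
    ring
  have wH (x : ℝ) : H' (1 - x) * H x + H' x * H (1 - x) = m * Complex.sinh m := by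
    have : m = m * ((1 - x : ℝ) : ℂ) + m * x := by push_cast; ring
    simp only [hH, hH']
    conv_rhs => rw [show Complex.sinh m = Complex.sinh (m * ((1 - x : ℝ) : ℂ) + m * x) by
      rw [← this], Complex.sinh_add]
    ring
  set YS : ℝ → ℂ := fun x => S (1 - x) * (∫ s in (0 : ℝ)..x, S s * q s) +
        S x * ∫ s in x..1, S (1 - s) * q s with hYS
  set YS' : ℝ → ℂ := fun x => -S' (1 - x) * (∫ s in (0 : ℝ)..x, S s * q s) +
        S' x * ∫ s in x..1, S (1 - s) * q s with hYS'
  set YH : ℝ → ℂ := fun x => H (1 - x) * (∫ s in (0 : ℝ)..x, H s * q s) +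
        H x * ∫ s in x..1, H (1 - s) * q s with hYH
  set YH' : ℝ → ℂ := fun x => -H' (1 - x) * (∫ s in (0 : ℝ)..x, H s * q s) +
        H' x * ∫ s in x..1, H (1 - s) * q s with hYH'
  have eS (x : ℝ) : HasDerivAt YS (YS' x) x := (hasDerivAt_potential dS dS' hqc x).1
  have eH (x : ℝ) : HasDerivAt YH (YH' x) x := (hasDerivAt_potential dH dH' hqc x).1
  have eS' (x : ℝ) : HasDerivAt YS' (-m ^ 2 * YS x - m * Complex.sin m * q x) x := by
    have := (hasDerivAt_potential dS dS' hqc x).2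
    rwa [wS] at this
  have eH' (x : ℝ) : HasDerivAt YH' (m ^ 2 * YH x - m * Complex.sinh m * q x) x := by
    have := (hasDerivAt_potential dH dH' hqc x).2
    rwa [wH] at this
  -- the solution and its derivatives
  let a : ℂ := 1 / (2 * m ^ 2) / (m * Complex.sin m)
  let b : ℂ := 1 / (2 * m ^ 2) / (m * Complex.sinh m)
  let Z0 : ℝ → ℂ := fun x => a * YS x - b * YH x
  let Z1 : ℝ → ℂ := fun x => a * YS' x - b * YH' x
  let Z2 : ℝ → ℂ := fun x => -m ^ 2 * a * YS x - m ^ 2 * b * YH x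
  let Z3 : ℝ → ℂ := fun x => -m ^ 2 * a * YS' x - m ^ 2 * b * YH' x
  let Z4 : ℝ → ℂ := fun x => -M * Z0 x + q x
  have z0 (x : ℝ) : HasDerivAt Z0 (Z1 x) x := ((eS x).const_mul a).sub ((eH x).const_mul b)
  have z1 (x : ℝ) : HasDerivAt Z1 (Z2 x) x := by
    refine (((eS' x).const_mul a).sub ((eH' x).const_mul b)).congr_deriv ?_
    simp only [Z2, a, b]
    field_simp
    ring
  have z2 (x : ℝ) : HasDerivAt Z2 (Z3 x) x :=
    ((eS x).const_mul (-m ^ 2 * a)).sub ((eH x).const_mul (m ^ 2 * b))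
  have z3 (x : ℝ) : HasDerivAt Z3 (Z4 x) x := by
    refine (((eS' x).const_mul (-m ^ 2 * a)).sub ((eH' x).const_mul (m ^ 2 * b))).congr_deriv ?_
    simp only [Z4, Z0, ← hm4, a, b]
    field_simp
    ring
  have re {Z : ℝ → ℂ} {z : ℂ} {x : ℝ} (h : HasDerivAt Z z x) :
      HasDerivAt (fun x => (Z x).re) z.re x :=
    Complex.reCLM.hasFDerivAt.comp_hasDerivAt x h
  have d0 : deriv (fun x => (Z0 x).re) = fun x => (Z1 x).re := funext fun x => (re (z0 x)).deriv
  have d1 : deriv (fun x => (Z1 x).re) = fun x => (Z2 x).re := funext fun x => (re (z1 x)).deriv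
  have d2 : deriv (fun x => (Z2 x).re) = fun x => (Z3 x).re := funext fun x => (re (z2 x)).deriv
  have d3 : deriv (fun x => (Z3 x).re) = fun x => (Z4 x).re := funext fun x => (re (z3 x)).deriv
  have c4 : Continuous fun x => (Z4 x).re := by
    have : Continuous Z0 := continuous_iff_continuousAt.2 fun x => (z0 x).continuousAt
    exact Complex.continuous_re.comp ((this.const_mul _).add hqc)
  have hZ : ContDiff ℝ 4 (fun x => (Z0 x).re) := by
    rw [show (4 : WithTop ℕ∞) = 3 + 1 by norm_num, contDiff_succ_iff_deriv]
    refine ⟨fun x => (re (z0 x)).differentiableAt, by simp, ?_⟩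
    rw [d0, show (3 : WithTop ℕ∞) = 2 + 1 by norm_num, contDiff_succ_iff_deriv]
    refine ⟨fun x => (re (z1 x)).differentiableAt, by simp, ?_⟩
    rw [d1, show (2 : WithTop ℕ∞) = 1 + 1 by norm_num, contDiff_succ_iff_deriv]
    refine ⟨fun x => (re (z2 x)).differentiableAt, by simp, ?_⟩
    rw [d2, contDiff_one_iff_deriv, d3]
    exact ⟨fun x => (re (z3 x)).differentiableAt, c4⟩
  have hi2 : iteratedDeriv 2 (fun x => (Z0 x).re) = fun x => (Z2 x).re := by
    rw [iteratedDeriv_succ', iteratedDeriv_succ', iteratedDeriv_zero, d0, d1]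
  have hi4 : iteratedDeriv 4 (fun x => (Z0 x).re) = fun x => (Z4 x).re := by
    rw [iteratedDeriv_succ', iteratedDeriv_succ', iteratedDeriv_succ', iteratedDeriv_succ',
      iteratedDeriv_zero, d0, d1, d2, d3]
  -- the potential is this solution
  have key : EqOn (fun x => ∫ s in (0 : ℝ)..1, green M x s * p s) (fun x => (Z0 x).re)
      (Icc 0 1) := by
    intro x hx
    let F : ℝ → ℂ := fun s => kernel m s ((1 - x : ℝ) : ℂ) * q s
    let E : ℝ → ℂ := fun s => kernel m x ((1 - s : ℝ) : ℂ) * q s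
    have hSc : Continuous S := continuous_iff_continuousAt.2 fun x => (dS x).continuousAt
    have hHc : Continuous H := continuous_iff_continuousAt.2 fun x => (dH x).continuousAt
    have hSr : Continuous fun s => S (1 - s) := hSc.comp (continuous_const.sub continuous_id)
    have hHr : Continuous fun s => H (1 - s) := hHc.comp (continuous_const.sub continuous_id)
    have F_eq : F = fun s => a * S (1 - x) * (S s * q s) - b * H (1 - x) * (H s * q s) := by
      funext s
      simp only [F, kernel, a, b, hS, hH]
      ring
    have E_eq : E = fun s => a * S x * (S (1 - s) * q s) - b * H x * (H (1 - s) * q s) := by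
      funext s
      simp only [E, kernel, a, b, hS, hH]
      ring
    have Fc : Continuous F := by rw [F_eq]; fun_prop
    have Ec : Continuous E := by rw [E_eq]; fun_prop
    have F_int : ∫ s in (0 : ℝ)..x, F s = a * S (1 - x) * (∫ s in (0 : ℝ)..x, S s * q s) -
        b * H (1 - x) * ∫ s in (0 : ℝ)..x, H s * q s := by
      rw [F_eq, integral_sub, integral_const_mul, integral_const_mul] <;>
        exact Continuous.intervalIntegrable (by fun_prop) _ _
    have E_int : ∫ s in x..1, E s = a * S x * (∫ s in x..1, S (1 - s) * q s) -
        b * H x * ∫ s in x..1, H (1 - s) * q s := by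
      rw [E_eq, integral_sub, integral_const_mul, integral_const_mul] <;>
        exact Continuous.intervalIntegrable (by fun_prop) _ _
    have g1 : EqOn (fun s => green M x s * p s) (fun s => (F s).re) (uIoo 0 x) := by
      intro s hs
      rw [uIoo_of_le hx.1] at hs
      simp only [green, if_neg (not_le.2 hs.2), F, hq,
        ← hPp s ⟨hs.1.le, hs.2.le.trans hx.2⟩, Complex.re_mul_ofReal, ← hm]
      push_cast
      rfl
    have g2 : EqOn (fun s => green M x s * p s) (fun s => (E s).re) (uIoo x 1) := by
      intro s hs
      rw [uIoo_of_le hx.2] at hs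
      simp only [green, if_pos hs.1.le, E, hq,
        ← hPp s ⟨hx.1.trans hs.1.le, hs.2.le⟩, Complex.re_mul_ofReal, ← hm]
      push_cast
      rfl
    have rF := Complex.continuous_re.comp Fc
    have rE := Complex.continuous_re.comp Ec
    have i1 : IntervalIntegrable (fun s => green M x s * p s) MeasureTheory.volume 0 x :=
      (rF.intervalIntegrable 0 x).congr_uIoo g1.symm
    have i2 : IntervalIntegrable (fun s => green M x s * p s) MeasureTheory.volume x 1 :=
      (rE.intervalIntegrable x 1).congr_uIoo g2.symm
    have t (f : ℝ → ℂ) (hf : Continuous f) (u v : ℝ) :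
        ∫ s in u..v, (f s).re = (∫ s in u..v, f s).re :=
      Complex.reCLM.intervalIntegral_comp_comm (hf.intervalIntegrable u v)
    calc ∫ s in (0 : ℝ)..1, green M x s * p s
        = (∫ s in (0 : ℝ)..x, green M x s * p s) + ∫ s in x..1, green M x s * p s :=
          (integral_add_adjacent_intervals i1 i2).symm
      _ = (∫ s in (0 : ℝ)..x, (F s).re) + ∫ s in x..1, (E s).re := by
          rw [integral_congr_uIoo g1, integral_congr_uIoo g2]
      _ = (Z0 x).re := by
          rw [t F Fc, t E Ec, ← Complex.add_re, F_int, E_int]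
          congr 1
          simp only [Z0, hYS, hYH]
          ring
  have m0 : (0 : ℝ) ∈ Icc (0 : ℝ) 1 := by simp
  have m1 : (1 : ℝ) ∈ Icc (0 : ℝ) 1 := by simp
  have ud : UniqueDiffOn ℝ (Icc (0 : ℝ) 1) := uniqueDiffOn_Icc zero_lt_one
  have hI (n : ℕ) (hn : n ≤ 4) (x : ℝ) (hx : x ∈ Icc (0 : ℝ) 1) :
      iteratedDerivWithin n (fun x => ∫ s in (0 : ℝ)..1, green M x s * p s) (Icc 0 1) x =
        iteratedDeriv n (fun x => (Z0 x).re) x := by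
    rw [iteratedDerivWithin_congr key hx]
    exact iteratedDerivWithin_eq_iteratedDeriv ud
      (hZ.contDiffAt.of_le (by exact_mod_cast hn)) hx
  have v0 : S 0 = 0 ∧ H 0 = 0 := by simp [hS, hH]
  have y0 : YS 0 = 0 ∧ YH 0 = 0 := by simp [hYS, hYH, v0.1, v0.2]
  have y1 : YS 1 = 0 ∧ YH 1 = 0 := by simp [hYS, hYH, v0.1, v0.2]
  refine ⟨hZ.contDiffOn.congr key, fun x hx => ?_, ?_, ?_, ?_, ?_⟩
  · have hx' := Ioo_subset_Icc_self hx
    have hk := key hx'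
    simp only at hk
    rw [hI 4 le_rfl x hx', hi4, hk, ← hPp x hx']
    simp [Z4, hq]
  · exact (key m0).trans (by simp [Z0, y0.1, y0.2])
  · exact (key m1).trans (by simp [Z0, y1.1, y1.2])
  · rw [hI 2 (by norm_num) 0 m0, hi2]
    simp [Z2, y0.1, y0.2]
  · rw [hI 2 (by norm_num) 1 m1, hi2]
    simp [Z2, y1.1, y1.2]

end GreenFunction

end

end NavierBVP

open Set NavierBVP

namespace NavierBVP

open Set

noncomputable section

/-! With `a = (M/4)^(1/4)` and `m = a(1 + i)` one has `m⁴ = -M`, and `M < c₁` means `a < k₁`. All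
real quantities are expressed through `S(t) = sin t cosh t` and `C(t) = cos t sinh t`, where `S + iC
= sin((1 + i)t)`. On `(0, k₁)` both `S + C` and `S - C` are positive, and the argument of `S + iC`
decreases (`sinCosh_mul_cosSinh_le`). These facts make the Green function nonnegative
(`green_nonneg`), and likewise the solution of `y⁽⁴⁾ + My = 0` with boundary data of the right signs
(`boundaryLift_nonneg`).

An energy identity (`IsSolution.eqOn_zero`) gives uniqueness for the local problem, so every
solution of the nonlocal problem satisfies `y = lift + ∫ G (p + N ∫ k y)`. Let `ρ = ‖k‖ |N| max ∫ G
< 1`. Suppose the data have the signs of (i) and the minimum of `y` is `-c < 0`. As `N k ≥ 0`, the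
density `p + N ∫ k y` is at least `-|N| ‖k‖ c`; as `G ≥ 0`, this yields `y ≥ -ρc > -c`, a
contradiction (`IsSolution.nonneg`). Part (ii) follows by `y ↦ -y`, and uniqueness by applying both
parts to a difference of solutions. For existence, the same `ρ` is a contraction constant on
`C[0,1]` for the right-hand side (`exists_isSolution`). -/

/-! ### Real and imaginary parts of `sin((1 + i)t)`, and their behaviour up to `k₁`. -/

/-- Real part of `sin ((1 + i) t)`. -/
def sinCosh (t : ℝ) : ℝ := Real.sin t * Real.cosh t

/-- Imaginary part of `sin ((1 + i) t)`. -/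
def cosSinh (t : ℝ) : ℝ := Real.cos t * Real.sinh t

theorem hasDerivAt_sinCosh (t : ℝ) : HasDerivAt sinCosh
    (Real.cos t * Real.cosh t + Real.sin t * Real.sinh t) t :=
  (Real.hasDerivAt_sin t).mul (Real.hasDerivAt_cosh t)

theorem hasDerivAt_cosSinh (t : ℝ) : HasDerivAt cosSinh
    (Real.cos t * Real.cosh t - Real.sin t * Real.sinh t) t :=
  ((Real.hasDerivAt_cos t).mul (Real.hasDerivAt_sinh t)).congr_deriv (by ring)

theorem hasDerivAt_deriv_sinCosh (t : ℝ) :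
    HasDerivAt (fun t => Real.cos t * Real.cosh t + Real.sin t * Real.sinh t)
      (2 * cosSinh t) t :=
  (((Real.hasDerivAt_cos t).mul (Real.hasDerivAt_cosh t)).add
    ((Real.hasDerivAt_sin t).mul (Real.hasDerivAt_sinh t))).congr_deriv
      (by rw [cosSinh]; ring)

theorem hasDerivAt_deriv_cosSinh (t : ℝ) :
    HasDerivAt (fun t => Real.cos t * Real.cosh t - Real.sin t * Real.sinh t)
      (-2 * sinCosh t) t :=
  (((Real.hasDerivAt_cos t).mul (Real.hasDerivAt_cosh t)).sub
    ((Real.hasDerivAt_sin t).mul (Real.hasDerivAt_sinh t))).congr_deriv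
      (by rw [sinCosh]; ring)

theorem continuous_sinCosh : Continuous sinCosh :=
  continuous_iff_continuousAt.2 fun t => (hasDerivAt_sinCosh t).continuousAt

theorem continuous_cosSinh : Continuous cosSinh :=
  continuous_iff_continuousAt.2 fun t => (hasDerivAt_cosSinh t).continuousAt

theorem tan_eq_neg_tanh {t : ℝ} (ht : 0 < t) (htπ : t < Real.pi)
    (h : sinCosh t + cosSinh t = 0) : Real.tan t = -Real.tanh t := by
  have hs : 0 < Real.sin t := Real.sin_pos_of_pos_of_lt_pi ht htπ
  have hc := Real.cosh_pos t
  have hcos : Real.cos t ≠ 0 := by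
    intro h0
    rw [sinCosh, cosSinh, h0] at h
    have := mul_pos hs hc
    linarith
  rw [sinCosh, cosSinh] at h
  rw [Real.tan_eq_sin_div_cos, Real.tanh_eq_sinh_div_cosh, ← neg_div, div_eq_div_iff hcos hc.ne']
  linarith

theorem bddBelow_tan_eq_neg_tanh :
    BddBelow {κ : ℝ | 0 < κ ∧ Real.tan κ = -Real.tanh κ} :=
  ⟨0, fun _ hx => hx.1.le⟩

theorem sinCosh_add_cosSinh_pos_of_le {t : ℝ} (h0 : 0 < t) (h : t ≤ Real.pi / 2) :
    0 < sinCosh t + cosSinh t := by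
  have hs : 0 < Real.sin t := Real.sin_pos_of_pos_of_lt_pi h0 (by linarith [Real.pi_pos])
  have hc : 0 ≤ Real.cos t := Real.cos_nonneg_of_mem_Icc ⟨by linarith, h⟩
  have h1 := mul_pos hs (Real.cosh_pos t)
  have h2 := mul_nonneg hc (Real.sinh_pos_iff.2 h0).le
  rw [sinCosh, cosSinh]
  linarith

/-- A sign change of `sin t cosh t + cos t sinh t` bounds `k₁`. -/
theorem k₁_le_of_nonpos {t : ℝ} (h0 : 0 < t) (htπ : t ≤ Real.pi)
    (h : sinCosh t + cosSinh t ≤ 0) : k₁ ≤ t := by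
  have hp : Real.pi / 2 ≤ t := by
    by_contra! hlt
    exact absurd (sinCosh_add_cosSinh_pos_of_le h0 hlt.le) (not_lt.2 h)
  -- The sum is positive on `(0, π/2]`, so a nonpositive value at `t` forces a zero `r ≤ t`. Only
  -- the infimum property of `k₁` enters; it need not be known that `k₁` itself is a root.
  obtain ⟨r, hr, hr0⟩ := intermediate_value_Icc' hp
    (continuous_sinCosh.add continuous_cosSinh).continuousOn
    ⟨h, (sinCosh_add_cosSinh_pos_of_le (by positivity) le_rfl).le⟩
  have hrpos : 0 < r := lt_of_lt_of_le (by positivity) hr.1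
  -- At `π` the sum is `-sinh π ≠ 0`, so the zero lies where `sin` is positive.
  have hrπ : r < Real.pi := by
    refine lt_of_le_of_ne (hr.2.trans htπ) ?_
    rintro rfl
    have := Real.sinh_pos_iff.2 Real.pi_pos
    simp [sinCosh, cosSinh] at hr0
  exact (csInf_le bddBelow_tan_eq_neg_tanh ⟨hrpos, tan_eq_neg_tanh hrpos hrπ hr0⟩).trans hr.2

theorem k₁_le_pi : k₁ ≤ Real.pi :=
  k₁_le_of_nonpos Real.pi_pos le_rfl (by
    have := Real.sinh_pos_iff.2 Real.pi_pos
    simp [sinCosh, cosSinh, this.le])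

theorem k₁_nonneg : 0 ≤ k₁ := Real.sInf_nonneg fun _ hx => hx.1.le

theorem sinCosh_add_cosSinh_pos {t : ℝ} (h0 : 0 < t) (h : t < k₁) :
    0 < sinCosh t + cosSinh t := by
  by_contra! hle
  exact absurd (k₁_le_of_nonpos h0 (h.le.trans k₁_le_pi) hle) (not_le.2 h)

/-- The difference vanishes at `0` and has derivative `2 sin t sinh t`. -/
theorem cosSinh_lt_sinCosh {t : ℝ} (h0 : 0 < t) (h : t ≤ Real.pi) : cosSinh t < sinCosh t := by
  have hm : StrictMonoOn (sinCosh - cosSinh) (Icc 0 Real.pi) := by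
    refine strictMonoOn_of_deriv_pos (convex_Icc _ _)
      (continuous_sinCosh.sub continuous_cosSinh).continuousOn fun t ht => ?_
    rw [interior_Icc] at ht
    rw [((hasDerivAt_sinCosh t).sub (hasDerivAt_cosSinh t)).deriv]
    have h2 := mul_pos (Real.sin_pos_of_pos_of_lt_pi ht.1 ht.2) (Real.sinh_pos_iff.2 ht.1)
    linarith
  simpa [sinCosh, cosSinh] using hm ⟨le_rfl, Real.pi_pos.le⟩ ⟨h0.le, h⟩ h0

/-- This is `sin 2t ≤ 2t ≤ sinh 2t`, halved. -/
theorem sin_mul_cos_le_sinh_mul_cosh {t : ℝ} (h : 0 ≤ t) :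
    Real.sin t * Real.cos t ≤ Real.sinh t * Real.cosh t := by
  have h1 := Real.sin_le (x := 2 * t) (by linarith)
  have h2 := Real.self_le_sinh_iff.2 (show 0 ≤ 2 * t by linarith)
  rw [Real.sin_two_mul] at h1
  rw [Real.sinh_two_mul] at h2
  linarith

/-- The argument of `sin ((1 + i) t)` decreases for `0 ≤ t < k₁`. -/
theorem sinCosh_mul_cosSinh_le {c a : ℝ} (h0 : 0 ≤ c) (hca : c ≤ a) (ha : a < k₁) :
    sinCosh c * cosSinh a ≤ sinCosh a * cosSinh c := by
  rcases h0.eq_or_lt with rfl | h0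
  · simp [sinCosh, cosSinh]
  have hd {t : ℝ} (ht : t ∈ Ioo 0 k₁) :=
    ((hasDerivAt_sinCosh t).sub (hasDerivAt_cosSinh t)).div
      ((hasDerivAt_sinCosh t).add (hasDerivAt_cosSinh t)) (sinCosh_add_cosSinh_pos ht.1 ht.2).ne'
  -- With `τ` the tangent of the argument, this quotient is `(1 - τ)/(1 + τ)`, which increases as
  -- the argument decreases. In this form it is also the quotient needed for `greenNum`.
  have hm : MonotoneOn ((sinCosh - cosSinh) / (sinCosh + cosSinh)) (Ioo 0 k₁) := by
    refine monotoneOn_of_deriv_nonneg (convex_Ioo _ _)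
      (fun t ht => (hd ht).continuousAt.continuousWithinAt)
      (fun t ht => (hd (interior_subset ht)).differentiableAt.differentiableWithinAt)
      fun t ht => ?_
    have ht := interior_subset ht
    rw [(hd ht).deriv]
    refine div_nonneg ?_ (sq_nonneg _)
    have h1 := sin_mul_cos_le_sinh_mul_cosh ht.1.le
    have h2 := Real.sin_sq_add_cos_sq t
    have h3 := Real.cosh_sq t
    simp only [Pi.sub_apply, Pi.add_apply, sinCosh, cosSinh]
    -- The numerator of the derivative is `2 (sinh t cosh t - sin t cos t)`.
    linear_combination 2 * h1 - 2 * Real.sinh t * Real.cosh t * h2 +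
      2 * Real.sin t * Real.cos t * h3
  have := hm ⟨h0, hca.trans_lt ha⟩ ⟨h0.trans_le hca, ha⟩ hca
  simp only [Pi.div_apply, Pi.sub_apply, Pi.add_apply] at this
  rw [div_le_div_iff₀ (sinCosh_add_cosSinh_pos h0 (hca.trans_lt ha))
    (sinCosh_add_cosSinh_pos (h0.trans_le hca) ha)] at this
  linarith

/-! ### Nonnegativity of the numerator of the Green function. -/

/-- The numerator of `green M x s`, `M = 4 a⁴`, for `u = a x` and `v = a (1 - s)`. -/
def greenNum (u v a : ℝ) : ℝ :=
  (sinCosh u * cosSinh v + cosSinh u * sinCosh v) * (sinCosh a - cosSinh a) -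
    (sinCosh u * sinCosh v - cosSinh u * cosSinh v) * (sinCosh a + cosSinh a)

theorem sinCosh_add (u v : ℝ) : sinCosh (u + v) =
    sinCosh u * (Real.cos v * Real.cosh v) + cosSinh u * (Real.sin v * Real.sinh v) +
      Real.cos u * Real.cosh u * sinCosh v + Real.sin u * Real.sinh u * cosSinh v := by
  rw [sinCosh, Real.sin_add, Real.cosh_add]
  simp only [sinCosh, cosSinh]
  ring

theorem cosSinh_add (u v : ℝ) : cosSinh (u + v) =
    cosSinh u * (Real.cos v * Real.cosh v) - sinCosh u * (Real.sin v * Real.sinh v) +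
      Real.cos u * Real.cosh u * cosSinh v - Real.sin u * Real.sinh u * sinCosh v := by
  rw [cosSinh, Real.cos_add, Real.sinh_add]
  simp only [sinCosh, cosSinh]
  ring

/-- The case `a = u + v` is the diagonal `x = s`. There the addition formulas turn the numerator
into a combination of two Wronskians with sums of squares as coefficients. -/
theorem greenNum_add_nonneg {u v : ℝ} (hu : 0 ≤ u) (hv : 0 ≤ v) : 0 ≤ greenNum u v (u + v) := by
  -- The left side is the Wronskian `C S' - S C'` of `S = sinCosh` and `C = cosSinh`.
  have key (t : ℝ) : sinCosh t * (Real.sin t * Real.sinh t - Real.cos t * Real.cosh t) +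
      cosSinh t * (Real.cos t * Real.cosh t + Real.sin t * Real.sinh t) =
      Real.sinh t * Real.cosh t - Real.sin t * Real.cos t := by
    rw [sinCosh, cosSinh]
    linear_combination Real.sinh t * Real.cosh t * Real.sin_sq_add_cos_sq t -
      Real.sin t * Real.cos t * Real.cosh_sq t
  have h : greenNum u v (u + v) =
      (sinCosh u ^ 2 + cosSinh u ^ 2) * (Real.sinh v * Real.cosh v - Real.sin v * Real.cos v) +
      (sinCosh v ^ 2 + cosSinh v ^ 2) *
        (Real.sinh u * Real.cosh u - Real.sin u * Real.cos u) := by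
    rw [greenNum, sinCosh_add, cosSinh_add, ← key u, ← key v]
    ring
  rw [h]
  have h1 := sub_nonneg.2 (sin_mul_cos_le_sinh_mul_cosh hu)
  have h2 := sub_nonneg.2 (sin_mul_cos_le_sinh_mul_cosh hv)
  positivity

/-- Write `α = S + C`, `β = S - C` and `sin((1+i)u) sin((1+i)v) = q + ip`. The claim is `p β(a) ≥ q
α(a)`. Since `β/α` increases and `p ≥ 0`, for fixed `u, v` it suffices to know it at the smallest
admissible value `a = c = u + v`. -/
theorem greenNum_nonneg {u v a : ℝ} (hu : 0 ≤ u) (hv : 0 ≤ v) (huv : u + v ≤ a) (ha : a < k₁) :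
    0 ≤ greenNum u v a := by
  rcases hu.eq_or_lt with rfl | hu'
  · simp [greenNum, sinCosh, cosSinh]
  set c := u + v with hc
  have hc0 : 0 < c := by positivity
  have hαc := sinCosh_add_cosSinh_pos hc0 (huv.trans_lt ha)
  have hαa := sinCosh_add_cosSinh_pos (hc0.trans_le huv) ha
  have hβ {t : ℝ} (h0 : 0 ≤ t) (h : t < k₁) : 0 ≤ sinCosh t - cosSinh t := by
    rcases h0.eq_or_lt with rfl | h0
    · simp [sinCosh, cosSinh]
    · exact (sub_pos.2 (cosSinh_lt_sinCosh h0 (h.le.trans k₁_le_pi))).le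
  have hα {t : ℝ} (h0 : 0 ≤ t) (h : t < k₁) : 0 ≤ sinCosh t + cosSinh t := by
    rcases h0.eq_or_lt with rfl | h0
    · simp [sinCosh, cosSinh]
    · exact (sinCosh_add_cosSinh_pos h0 h).le
  have hβc := sub_pos.2 (cosSinh_lt_sinCosh hc0 ((huv.trans ha.le).trans k₁_le_pi))
  have hF := sinCosh_mul_cosSinh_le hc0.le huv ha
  have hadd := greenNum_add_nonneg hu hv
  rw [← hc] at hadd
  have hul : u < k₁ := by linarith
  have hvl : v < k₁ := by linarith
  rw [greenNum] at hadd ⊢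
  set p := sinCosh u * cosSinh v + cosSinh u * sinCosh v with hp
  set q := sinCosh u * sinCosh v - cosSinh u * cosSinh v with hq
  -- `2q = α(u) β(v) + α(v) β(u)`.
  have hq0 : 0 ≤ q := by
    have h1 := mul_nonneg (hα hu hul) (hβ hv hvl)
    have h2 := mul_nonneg (hα hv hvl) (hβ hu hul)
    rw [hq]
    linarith
  -- The diagonal case reads `p β(c) ≥ q α(c) ≥ 0`, and `β(c) > 0`.
  have hp0 : 0 ≤ p :=
    nonneg_of_mul_nonneg_left (by linarith [mul_nonneg hq0 hαc.le]) hβc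
  have h1 := mul_nonneg hαa.le hadd
  have h2 := mul_nonneg hp0 (sub_nonneg.2 hF)
  refine nonneg_of_mul_nonneg_left (b := sinCosh c + cosSinh c) ?_ hαc
  -- `α(c) greenNum(u,v,a) = α(a) greenNum(u,v,c) + 2p (S(a) C(c) - S(c) C(a))`.
  linear_combination h1 + 2 * h2

/-! ### From the complex kernel to its real form. -/

/-- The real parameter `a` with `root M = a (1 + i)`. -/
def freq (M : ℝ) : ℝ := √(√(M / 4))

theorem freq_pos {M : ℝ} (hM : 0 < M) : 0 < freq M := by
  unfold freq
  positivity

theorem four_mul_freq_pow {M : ℝ} (hM : 0 ≤ M) : 4 * freq M ^ 4 = M := by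
  rw [freq, show (4 : ℕ) = 2 * 2 from rfl, pow_mul, Real.sq_sqrt (Real.sqrt_nonneg _),
    Real.sq_sqrt (by positivity)]
  ring

theorem freq_lt {M : ℝ} (hM : 0 ≤ M) (h : M < c₁) : freq M < k₁ := by
  rw [c₁, ← four_mul_freq_pow hM] at h
  exact lt_of_pow_lt_pow_left₀ 4 k₁_nonneg (by linarith)

theorem sin_root_mul (M t : ℝ) : Complex.sin (root M * t) =
    sinCosh (freq M * t) + cosSinh (freq M * t) * Complex.I := by
  have : root M * t = ((freq M * t : ℝ) : ℂ) + ((freq M * t : ℝ) : ℂ) * Complex.I := by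
    rw [root, freq]
    push_cast
    ring
  rw [this, Complex.sin_add_mul_I, sinCosh, cosSinh]
  push_cast
  ring

theorem sinh_root_mul (M t : ℝ) : Complex.sinh (root M * t) =
    cosSinh (freq M * t) + sinCosh (freq M * t) * Complex.I := by
  have : root M * t = ((freq M * t : ℝ) : ℂ) + ((freq M * t : ℝ) : ℂ) * Complex.I := by
    rw [root, freq]
    push_cast
    ring
  rw [this, Complex.sinh_add, Complex.sinh_mul_I, Complex.cosh_mul_I, sinCosh, cosSinh]
  push_cast
  ring

theorem sinCosh_sq_add_cosSinh_sq_pos {t : ℝ} (ht : 0 < t) :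
    0 < sinCosh t ^ 2 + cosSinh t ^ 2 := by
  have h : sinCosh t ^ 2 + cosSinh t ^ 2 = Real.sin t ^ 2 + Real.sinh t ^ 2 := by
    rw [sinCosh, cosSinh]
    linear_combination Real.sin t ^ 2 * Real.cosh_sq t +
      Real.sinh t ^ 2 * Real.sin_sq_add_cos_sq t
  rw [h]
  have := Real.sinh_pos_iff.2 ht
  positivity

/-- Since `sinh(mt) = i · conj(sin(mt))` for `m = a(1 + i)`, the two terms of the kernel are complex
conjugates. Their sum is twice a real part, and clearing `|sin m|²` leaves `greenNum`. -/
theorem kernel_root {M : ℝ} (hM : 0 < M) (u v : ℝ) :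
    kernel (root M) u v =
      ((greenNum (freq M * u) (freq M * v) (freq M) /
        (4 * freq M ^ 3 * (sinCosh (freq M) ^ 2 + cosSinh (freq M) ^ 2)) : ℝ) : ℂ) := by
  set a := freq M with ha
  have ha0 : (a : ℂ) ≠ 0 := by exact_mod_cast (freq_pos hM).ne'
  set D := sinCosh a ^ 2 + cosSinh a ^ 2 with hD
  have hD0 : (D : ℂ) ≠ 0 := by
    exact_mod_cast (sinCosh_sq_add_cosSinh_sq_pos (freq_pos hM)).ne'
  have hDc : (D : ℂ) = sinCosh a ^ 2 + cosSinh a ^ 2 := by rw [hD]; push_cast; rfl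
  have hI := Complex.I_sq
  have h1 : Complex.sin (root M) = sinCosh a + cosSinh a * Complex.I := by
    simpa using sin_root_mul M 1
  have h2 : Complex.sinh (root M) = cosSinh a + sinCosh a * Complex.I := by
    simpa using sinh_root_mul M 1
  have i1 : (Complex.sin (root M))⁻¹ = (sinCosh a - cosSinh a * Complex.I) / D := by
    refine inv_eq_of_mul_eq_one_right ?_
    rw [h1, ← mul_div_assoc, div_eq_one_iff_eq hD0, hDc]
    linear_combination -(cosSinh a : ℂ) ^ 2 * hI
  have i2 : (Complex.sinh (root M))⁻¹ = (cosSinh a - sinCosh a * Complex.I) / D := by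
    refine inv_eq_of_mul_eq_one_right ?_
    rw [h2, ← mul_div_assoc, div_eq_one_iff_eq hD0, hDc]
    linear_combination -(sinCosh a : ℂ) ^ 2 * hI
  have i3 : (root M ^ 3)⁻¹ = -(1 + Complex.I) / (4 * a ^ 3) := by
    have hr : root M = a * (1 + Complex.I) := rfl
    refine inv_eq_of_mul_eq_one_right ?_
    rw [hr, ← mul_div_assoc, div_eq_one_iff_eq (by simpa using ha0)]
    linear_combination -(a : ℂ) ^ 3 * (Complex.I ^ 2 + 4 * Complex.I + 5) * hI
  have e : kernel (root M) u v = 1 / 2 * (root M ^ 3)⁻¹ *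
      (Complex.sin (root M * u) * Complex.sin (root M * v) * (Complex.sin (root M))⁻¹ -
      Complex.sinh (root M * u) * Complex.sinh (root M * v) * (Complex.sinh (root M))⁻¹) := by
    rw [kernel]
    field_simp
  rw [e, i1, i2, i3, sin_root_mul, sin_root_mul, sinh_root_mul, sinh_root_mul, greenNum, ← ha]
  push_cast
  field_simp
  apply Complex.ext
  · simp
    ring
  · simp
    ring

theorem kernel_root_re_nonneg {M u v : ℝ} (hM : 0 < M) (h : M < c₁) (hu : 0 ≤ u) (hv : 0 ≤ v)
    (huv : u + v ≤ 1) : 0 ≤ (kernel (root M) u v).re := by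
  have ha := freq_pos hM
  rw [kernel_root hM, Complex.ofReal_re]
  refine div_nonneg (greenNum_nonneg (by positivity) (by positivity) ?_ (freq_lt hM.le h))
    (by positivity)
  rw [← mul_add]
  exact mul_le_of_le_one_right ha.le huv

theorem green_nonneg {M x s : ℝ} (hM : 0 < M) (h : M < c₁) (hx : x ∈ Icc (0 : ℝ) 1)
    (hs : s ∈ Icc (0 : ℝ) 1) : 0 ≤ green M x s := by
  unfold green
  split_ifs with hxs
  · have := kernel_root_re_nonneg hM h hx.1 (sub_nonneg.2 hs.2) (by linarith)
    push_cast at this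
    exact this
  · have := kernel_root_re_nonneg hM h hs.1 (sub_nonneg.2 hx.2) (by linarith)
    push_cast at this
    exact this

theorem continuous_green (M x : ℝ) : Continuous (green M x) := by
  unfold green kernel
  refine Continuous.if_le ?_ ?_ continuous_const continuous_id fun s hs => by rw [hs]
  · fun_prop
  · fun_prop

/-! ### Order and norm bounds for the Green potential. -/

/-- The Green potential of `q`. -/
def potential (M : ℝ) (q : ℝ → ℝ) (x : ℝ) : ℝ := ∫ s in (0 : ℝ)..1, green M x s * q s

theorem isSolution_potential {M : ℝ} (hM : 0 < M) {q : ℝ → ℝ} (hq : ContinuousOn q (Icc 0 1)) :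
    IsSolution M 0 (fun _ _ => 0) q 0 0 0 0 (potential M q) :=
  isSolution_green hM hq

theorem intervalIntegrable_green_mul (M x : ℝ) {q : ℝ → ℝ} (hq : ContinuousOn q (Icc 0 1)) :
    IntervalIntegrable (fun s => green M x s * q s) MeasureTheory.volume 0 1 :=
  ContinuousOn.intervalIntegrable
    (by rw [uIcc_of_le zero_le_one]; exact (continuous_green M x).continuousOn.mul hq)

theorem potential_one_le {M : ℝ} (hM : 0 < M) {x : ℝ} (hx : x ∈ Icc (0 : ℝ) 1) :
    potential M (fun _ => 1) x ≤ greenMax M := by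
  have hc : ContinuousOn (potential M fun _ => 1) (Icc 0 1) :=
    (isSolution_potential hM continuousOn_const).contDiffOn.continuousOn
  have he : (fun x => ∫ s in (0 : ℝ)..1, green M x s) = potential M fun _ => 1 := by
    funext x
    simp [potential]
  rw [greenMax, he]
  exact le_csSup (isCompact_Icc.image_of_continuousOn hc).bddAbove (mem_image_of_mem _ hx)

theorem potential_nonneg {M : ℝ} (hM : 0 < M) (h : M < c₁) {q : ℝ → ℝ}
    (hq : ∀ s ∈ Icc (0 : ℝ) 1, 0 ≤ q s) {x : ℝ} (hx : x ∈ Icc (0 : ℝ) 1) :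
    0 ≤ potential M q x :=
  intervalIntegral.integral_nonneg zero_le_one fun s hs =>
    mul_nonneg (green_nonneg hM h hx hs) (hq s hs)

theorem greenMax_nonneg {M : ℝ} (hM : 0 < M) (h : M < c₁) : 0 ≤ greenMax M :=
  (potential_nonneg hM h (fun _ _ => zero_le_one) ⟨le_rfl, zero_le_one⟩).trans
    (potential_one_le hM ⟨le_rfl, zero_le_one⟩)

/-- Adding `c` makes the density nonnegative, and the potential of the constant `c` is at most `c *
greenMax M`. This one-sided bound drives the sign argument; applied to `q` and `-q` it gives the
contraction estimate. -/
theorem potential_ge {M : ℝ} (hM : 0 < M) (h : M < c₁) {q : ℝ → ℝ}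
    (hqc : ContinuousOn q (Icc 0 1)) {c : ℝ} (hc : 0 ≤ c)
    (hq : ∀ s ∈ Icc (0 : ℝ) 1, -c ≤ q s) {x : ℝ} (hx : x ∈ Icc (0 : ℝ) 1) :
    -(c * greenMax M) ≤ potential M q x := by
  have h1 : 0 ≤ potential M (fun s => q s + c) x :=
    potential_nonneg hM h (fun s hs => by linarith [hq s hs]) hx
  have h2 : potential M (fun s => q s + c) x =
      potential M q x + c * potential M (fun _ => 1) x := by
    simp only [potential]
    rw [← intervalIntegral.integral_const_mul, ← intervalIntegral.integral_add
      (intervalIntegrable_green_mul M x hqc)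
      ((intervalIntegrable_green_mul M x continuousOn_const).const_mul c)]
    congr 1
    funext s
    ring
  have h3 := mul_le_mul_of_nonneg_left (potential_one_le hM hx) hc
  linarith

theorem potential_sub (M x : ℝ) {q r : ℝ → ℝ}
    (hq : ContinuousOn q (Icc 0 1)) (hr : ContinuousOn r (Icc 0 1)) :
    potential M (fun s => q s - r s) x = potential M q x - potential M r x := by
  simp only [potential]
  rw [← intervalIntegral.integral_sub (intervalIntegrable_green_mul M x hq)
    (intervalIntegrable_green_mul M x hr)]
  simp only [mul_sub]

theorem abs_potential_le {M : ℝ} (hM : 0 < M) (h : M < c₁) {q : ℝ → ℝ}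
    (hqc : ContinuousOn q (Icc 0 1)) {c : ℝ} (hc : 0 ≤ c)
    (hq : ∀ s ∈ Icc (0 : ℝ) 1, |q s| ≤ c) {x : ℝ} (hx : x ∈ Icc (0 : ℝ) 1) :
    |potential M q x| ≤ c * greenMax M := by
  have h1 := potential_ge hM h hqc hc (fun s hs => (abs_le.1 (hq s hs)).1) hx
  have h2 := potential_ge hM h (hqc.neg) hc
    (fun s hs => neg_le_neg (abs_le.1 (hq s hs)).2) hx
  have h3 : potential M (-q) x = -potential M q x := by
    simp only [potential, Pi.neg_apply, mul_neg, intervalIntegral.integral_neg]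
  rw [abs_le]
  constructor <;> linarith

/-! ### Linear structure of the solution set -/

namespace IsSolution

variable {M N : ℝ} {k : ℝ → ℝ → ℝ} {p p' : ℝ → ℝ} {A B C D A' B' C' D' : ℝ} {y z : ℝ → ℝ}

theorem congr (h : IsSolution M N k p A B C D y) (he : EqOn z y (Icc 0 1)) :
    IsSolution M N k p A B C D z := by
  have m0 : (0 : ℝ) ∈ Icc (0 : ℝ) 1 := by simp
  have m1 : (1 : ℝ) ∈ Icc (0 : ℝ) 1 := by simp
  refine ⟨h.contDiffOn.congr he, fun x hx => ?_, (he m0).trans h.left, (he m1).trans h.right,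
    (iteratedDerivWithin_congr he m0).trans h.left₂,
    (iteratedDerivWithin_congr he m1).trans h.right₂⟩
  have hx' := Ioo_subset_Icc_self hx
  have hi : ∫ t in (0 : ℝ)..1, k x t * z t = ∫ t in (0 : ℝ)..1, k x t * y t :=
    intervalIntegral.integral_congr fun t ht => by
      rw [uIcc_of_le zero_le_one] at ht
      simp only [he ht]
  rw [iteratedDerivWithin_congr he hx', he hx', hi]
  exact h.equation x hx

/-- The nonlocal term may be moved to the right-hand side. -/
theorem local_iff : IsSolution M 0 (fun _ _ => 0)
      (fun x => p x + N * ∫ t in (0 : ℝ)..1, k x t * y t) A B C D y ↔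
    IsSolution M N k p A B C D y := by
  constructor
  · intro h
    refine ⟨h.contDiffOn, fun x hx => ?_, h.left, h.right, h.left₂, h.right₂⟩
    have := h.equation x hx
    simp only [zero_mul, intervalIntegral.integral_zero] at this
    linarith
  · intro h
    refine ⟨h.contDiffOn, fun x hx => ?_, h.left, h.right, h.left₂, h.right₂⟩
    have := h.equation x hx
    simp only [zero_mul, intervalIntegral.integral_zero]
    linarith

theorem neg (h : IsSolution M N k p A B C D y) :
    IsSolution M N k (-p) (-A) (-B) (-C) (-D) (-y) := by
  refine ⟨h.contDiffOn.neg, fun x hx => ?_, ?_, ?_, ?_, ?_⟩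
  · rw [iteratedDerivWithin_neg]
    have := h.equation x hx
    simp only [Pi.neg_apply, mul_neg, intervalIntegral.integral_neg]
    linarith
  · simp [h.left]
  · simp [h.right]
  · simp [iteratedDerivWithin_neg, h.left₂]
  · simp [iteratedDerivWithin_neg, h.right₂]

theorem iteratedDerivWithin_add (hy : IsSolution M N k p A B C D y)
    (hz : IsSolution M N k p' A' B' C' D' z) {n : ℕ} (hn : n ≤ 4) {x : ℝ}
    (hx : x ∈ Icc (0 : ℝ) 1) : iteratedDerivWithin n (y + z) (Icc 0 1) x =
      iteratedDerivWithin n y (Icc 0 1) x + iteratedDerivWithin n z (Icc 0 1) x :=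
  _root_.iteratedDerivWithin_add hx (uniqueDiffOn_Icc zero_lt_one)
    ((hy.contDiffOn x hx).of_le (by exact_mod_cast hn))
    ((hz.contDiffOn x hx).of_le (by exact_mod_cast hn))

theorem add (hk : ContinuousOn (fun q : ℝ × ℝ => k q.1 q.2) (Icc 0 1 ×ˢ Icc 0 1))
    (hy : IsSolution M N k p A B C D y) (hz : IsSolution M N k p' A' B' C' D' z) :
    IsSolution M N k (p + p') (A + A') (B + B') (C + C') (D + D') (y + z) := by
  have m0 : (0 : ℝ) ∈ Icc (0 : ℝ) 1 := by simp
  have m1 : (1 : ℝ) ∈ Icc (0 : ℝ) 1 := by simp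
  refine ⟨hy.contDiffOn.add hz.contDiffOn, fun x hx => ?_, ?_, ?_, ?_, ?_⟩
  · have hx' := Ioo_subset_Icc_self hx
    have hkx : ContinuousOn (k x) (Icc 0 1) :=
      hk.comp (f := fun t => (x, t)) (by fun_prop) fun t ht => ⟨hx', ht⟩
    have hI {w : ℝ → ℝ} (hw : ContinuousOn w (Icc 0 1)) :
        IntervalIntegrable (fun t => k x t * w t) MeasureTheory.volume 0 1 :=
      ContinuousOn.intervalIntegrable (by rw [uIcc_of_le zero_le_one]; exact hkx.mul hw)
    rw [iteratedDerivWithin_add hy hz le_rfl hx']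
    simp only [Pi.add_apply, mul_add]
    rw [intervalIntegral.integral_add (hI hy.contDiffOn.continuousOn)
      (hI hz.contDiffOn.continuousOn)]
    have h1 := hy.equation x hx
    have h2 := hz.equation x hx
    linarith
  · simp [hy.left, hz.left]
  · simp [hy.right, hz.right]
  · rw [iteratedDerivWithin_add hy hz (by norm_num) m0, hy.left₂, hz.left₂]
  · rw [iteratedDerivWithin_add hy hz (by norm_num) m1, hy.right₂, hz.right₂]

/-- The homogeneous local problem has only the trivial solution: `y''' y - y'' y'` vanishes at
both end points and has derivative `-M y² - y''²`. -/
theorem eqOn_zero (hM : 0 < M) (h : IsSolution M 0 (fun _ _ => 0) 0 0 0 0 0 y) :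
    EqOn y 0 (Icc 0 1) := by
  have ud : UniqueDiffOn ℝ (Icc (0 : ℝ) 1) := uniqueDiffOn_Icc zero_lt_one
  set Y : ℕ → ℝ → ℝ := fun n => iteratedDerivWithin n y (Icc 0 1) with hY
  have hY0 : Y 0 = y := iteratedDerivWithin_zero
  have hd (n : ℕ) (hn : n < 4) (x : ℝ) (hx : x ∈ Ioo (0 : ℝ) 1) :
      HasDerivAt (Y n) (Y (n + 1) x) x := by
    have hx' := Ioo_subset_Icc_self hx
    have := (h.contDiffOn.differentiableOn_iteratedDerivWithin (m := n)
      (by exact_mod_cast hn) ud x hx').hasDerivWithinAt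
    rw [← iteratedDerivWithin_succ] at this
    exact this.hasDerivAt (Icc_mem_nhds hx.1 hx.2)
  have hc (n : ℕ) (hn : n ≤ 4) : ContinuousOn (Y n) (Icc 0 1) :=
    h.contDiffOn.continuousOn_iteratedDerivWithin (by exact_mod_cast hn) ud
  set E : ℝ → ℝ := Y 3 * Y 0 - Y 2 * Y 1 with hE
  have hEd (x : ℝ) (hx : x ∈ Ioo (0 : ℝ) 1) : HasDerivAt E (-(M * y x ^ 2 + Y 2 x ^ 2)) x := by
    refine (((hd 3 (by norm_num) x hx).mul (hd 0 (by norm_num) x hx)).sub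
      ((hd 2 (by norm_num) x hx).mul (hd 1 (by norm_num) x hx))).congr_deriv ?_
    have he := h.equation x hx
    simp only [zero_mul, sub_zero, Pi.zero_apply] at he
    change Y 4 x + M * y x = 0 at he
    rw [hY0]
    linear_combination y x * he
  have hEc : ContinuousOn E (Icc 0 1) :=
    ((hc 3 (by norm_num)).mul (hc 0 (by norm_num))).sub
      ((hc 2 (by norm_num)).mul (hc 1 (by norm_num)))
  have hanti : AntitoneOn E (Icc 0 1) := by
    refine antitoneOn_of_deriv_nonpos (convex_Icc _ _) hEc ?_ ?_
    · rw [interior_Icc]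
      exact fun x hx => (hEd x hx).differentiableAt.differentiableWithinAt
    · rw [interior_Icc]
      intro x hx
      rw [(hEd x hx).deriv]
      have := mul_nonneg hM.le (sq_nonneg (y x))
      have := sq_nonneg (Y 2 x)
      linarith
  have m0 : (0 : ℝ) ∈ Icc (0 : ℝ) 1 := by simp
  have m1 : (1 : ℝ) ∈ Icc (0 : ℝ) 1 := by simp
  have e0 : E 0 = 0 := by
    have h2 : Y 2 0 = 0 := h.left₂
    simp [hE, hY0, h.left, h2]
  have e1 : E 1 = 0 := by
    have h2 : Y 2 1 = 0 := h.right₂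
    simp [hE, hY0, h.right, h2]
  have hE0 (x : ℝ) (hx : x ∈ Icc (0 : ℝ) 1) : E x = 0 := by
    have h1 := hanti m0 hx hx.1
    have h2 := hanti hx m1 hx.2
    linarith
  intro x hx
  rcases hx.1.eq_or_lt with rfl | hx0
  · exact h.left
  rcases hx.2.eq_or_lt with rfl | hx1
  · exact h.right
  -- `E` is antitone with equal end values, hence zero; so its derivative `-(M y² + y''²)` vanishes
  -- and both squares are zero.
  have hloc : E =ᶠ[nhds x] fun _ => 0 := by
    filter_upwards [Icc_mem_nhds hx0 hx1] with t ht using hE0 t ht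
  have h0 := (hEd x ⟨hx0, hx1⟩).unique ((hasDerivAt_const x (0 : ℝ)).congr_of_eventuallyEq hloc)
  have h1 : M * y x ^ 2 = 0 := by
    have := mul_nonneg hM.le (sq_nonneg (y x))
    have := sq_nonneg (Y 2 x)
    linarith
  simpa [hM.ne'] using h1

end IsSolution

/-! ### Boundary data -/

/-- The solution of `y⁽⁴⁾ + M y = 0` with `y(1) = 1`, `y(0) = y''(0) = y''(1) = 0`. -/
def valueProfile (a x : ℝ) : ℝ :=
  (sinCosh (a * x) * sinCosh a + cosSinh (a * x) * cosSinh a) / (sinCosh a ^ 2 + cosSinh a ^ 2)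

/-- The solution of `y⁽⁴⁾ + M y = 0` with `y''(1) = -1`, `y(0) = y(1) = y''(0) = 0`. -/
def curvatureProfile (a x : ℝ) : ℝ :=
  (cosSinh (a * x) * sinCosh a - sinCosh (a * x) * cosSinh a) /
    (2 * a ^ 2 * (sinCosh a ^ 2 + cosSinh a ^ 2))

theorem contDiff_sinCosh : ContDiff ℝ 4 sinCosh := Real.contDiff_sin.mul Real.contDiff_cosh

theorem contDiff_cosSinh : ContDiff ℝ 4 cosSinh := Real.contDiff_cos.mul Real.contDiff_sinh

theorem contDiff_valueProfile (a : ℝ) : ContDiff ℝ 4 (valueProfile a) := by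
  have h1 := contDiff_sinCosh
  have h2 := contDiff_cosSinh
  unfold valueProfile
  fun_prop

theorem contDiff_curvatureProfile (a : ℝ) : ContDiff ℝ 4 (curvatureProfile a) := by
  have h1 := contDiff_sinCosh
  have h2 := contDiff_cosSinh
  unfold curvatureProfile
  fun_prop

theorem hasDerivAt_comp_mul_left {f f' : ℝ → ℝ} (a : ℝ) (h : ∀ t, HasDerivAt f (f' t) t)
    (x : ℝ) : HasDerivAt (fun x => f (a * x)) (a * f' (a * x)) x := by
  have l : HasDerivAt (fun x => a * x) a x := by simpa using (hasDerivAt_id x).const_mul a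
  exact ((h (a * x)).comp x l).congr_deriv (mul_comm _ _)

theorem hasDerivAt_reflect {f f' : ℝ → ℝ} (h : ∀ t, HasDerivAt f (f' t) t) (x : ℝ) :
    HasDerivAt (fun x => f (1 - x)) (-f' (1 - x)) x := by
  simpa [Function.comp_def] using (h (1 - x)).scomp x ((hasDerivAt_id x).const_sub 1)

/-- The derivative of `valueProfile`. -/
def valueSlope (a x : ℝ) : ℝ :=
  (a * (Real.cos (a * x) * Real.cosh (a * x) + Real.sin (a * x) * Real.sinh (a * x)) * sinCosh a +
    a * (Real.cos (a * x) * Real.cosh (a * x) - Real.sin (a * x) * Real.sinh (a * x)) *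
      cosSinh a) / (sinCosh a ^ 2 + cosSinh a ^ 2)

/-- The derivative of `curvatureProfile`. -/
def curvatureSlope (a x : ℝ) : ℝ :=
  (a * (Real.cos (a * x) * Real.cosh (a * x) - Real.sin (a * x) * Real.sinh (a * x)) * sinCosh a -
    a * (Real.cos (a * x) * Real.cosh (a * x) + Real.sin (a * x) * Real.sinh (a * x)) *
      cosSinh a) / (2 * a ^ 2 * (sinCosh a ^ 2 + cosSinh a ^ 2))

theorem hasDerivAt_valueProfile (a x : ℝ) :
    HasDerivAt (valueProfile a) (valueSlope a x) x :=
  (((hasDerivAt_comp_mul_left a hasDerivAt_sinCosh x).mul_const _).add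
    ((hasDerivAt_comp_mul_left a hasDerivAt_cosSinh x).mul_const _)).div_const _

theorem hasDerivAt_curvatureProfile (a x : ℝ) :
    HasDerivAt (curvatureProfile a) (curvatureSlope a x) x :=
  (((hasDerivAt_comp_mul_left a hasDerivAt_cosSinh x).mul_const _).sub
    ((hasDerivAt_comp_mul_left a hasDerivAt_sinCosh x).mul_const _)).div_const _

/-- Let `f(x) = sin(mx)/sin m` with `m = a(1 + i)`. Then `valueProfile a = Re f` and
`curvatureProfile a = Im f / (2a²)`. As `f'' = -m² f = -2ia² f`, two differentiations exchange the
profiles up to constants. -/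
theorem hasDerivAt_valueSlope {a : ℝ} (ha : 0 < a) (x : ℝ) :
    HasDerivAt (valueSlope a) (4 * a ^ 4 * curvatureProfile a x) x := by
  have hD := (sinCosh_sq_add_cosSinh_sq_pos ha).ne'
  refine ((((hasDerivAt_comp_mul_left a hasDerivAt_deriv_sinCosh x).const_mul a).mul_const _).add
    (((hasDerivAt_comp_mul_left a hasDerivAt_deriv_cosSinh x).const_mul a).mul_const _)
      |>.div_const _).congr_deriv ?_
  rw [curvatureProfile]
  field_simp
  ring

theorem hasDerivAt_curvatureSlope {a : ℝ} (ha : 0 < a) (x : ℝ) :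
    HasDerivAt (curvatureSlope a) (-valueProfile a x) x := by
  have hD := (sinCosh_sq_add_cosSinh_sq_pos ha).ne'
  refine ((((hasDerivAt_comp_mul_left a hasDerivAt_deriv_cosSinh x).const_mul a).mul_const _).sub
    (((hasDerivAt_comp_mul_left a hasDerivAt_deriv_sinCosh x).const_mul a).mul_const _)
      |>.div_const _).congr_deriv ?_
  rw [valueProfile]
  field_simp
  ring

/-- Twice the numerator is `α(ax) α(a) + β(ax) β(a)` with `α = sinCosh + cosSinh` and `β = sinCosh -
cosSinh`, all nonnegative below `k₁`. -/
theorem valueProfile_nonneg {a x : ℝ} (ha : 0 < a) (ha' : a < k₁) (hx : x ∈ Icc (0 : ℝ) 1) :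
    0 ≤ valueProfile a x := by
  have hα {t : ℝ} (h0 : 0 ≤ t) (h : t < k₁) :
      0 ≤ sinCosh t + cosSinh t ∧ 0 ≤ sinCosh t - cosSinh t := by
    rcases h0.eq_or_lt with rfl | h0
    · simp [sinCosh, cosSinh]
    · exact ⟨(sinCosh_add_cosSinh_pos h0 h).le,
        (sub_pos.2 (cosSinh_lt_sinCosh h0 (h.le.trans k₁_le_pi))).le⟩
  obtain ⟨h1, h2⟩ := hα ha.le ha'
  obtain ⟨h3, h4⟩ := hα (mul_nonneg ha.le hx.1) ((mul_le_of_le_one_right ha.le hx.2).trans_lt ha')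
  refine div_nonneg ?_ (by positivity)
  linear_combination (mul_nonneg h1 h3 + mul_nonneg h2 h4) / 2

/-- The numerator is nonnegative exactly because the argument of `sin((1 + i)t)` decreases from `ax`
to `a`. -/
theorem curvatureProfile_nonneg {a x : ℝ} (ha : 0 < a) (ha' : a < k₁)
    (hx : x ∈ Icc (0 : ℝ) 1) : 0 ≤ curvatureProfile a x := by
  refine div_nonneg ?_ (by positivity)
  have := sinCosh_mul_cosSinh_le (mul_nonneg ha.le hx.1) (mul_le_of_le_one_right ha.le hx.2) ha'
  linarith

/-- The solution of `y⁽⁴⁾ + M y = 0`, `M = 4 a⁴`, with given boundary data. -/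
def boundaryLift (a A B C D x : ℝ) : ℝ :=
  A * valueProfile a (1 - x) + B * valueProfile a x - C * curvatureProfile a (1 - x) -
    D * curvatureProfile a x

theorem boundaryLift_nonneg {a A B C D x : ℝ} (ha : 0 < a) (ha' : a < k₁) (hA : 0 ≤ A)
    (hB : 0 ≤ B) (hC : C ≤ 0) (hD : D ≤ 0) (hx : x ∈ Icc (0 : ℝ) 1) :
    0 ≤ boundaryLift a A B C D x := by
  have hx' : 1 - x ∈ Icc (0 : ℝ) 1 := ⟨by linarith [hx.2], by linarith [hx.1]⟩
  have h1 := mul_nonneg hA (valueProfile_nonneg ha ha' hx')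
  have h2 := mul_nonneg hB (valueProfile_nonneg ha ha' hx)
  have h3 := mul_nonneg_of_nonpos_of_nonpos hC
    (neg_nonpos.2 (curvatureProfile_nonneg ha ha' hx'))
  have h4 := mul_nonneg_of_nonpos_of_nonpos hD
    (neg_nonpos.2 (curvatureProfile_nonneg ha ha' hx))
  rw [boundaryLift]
  linarith

theorem valueProfile_zero (a : ℝ) : valueProfile a 0 = 0 := by
  simp [valueProfile, sinCosh, cosSinh]

theorem curvatureProfile_zero (a : ℝ) : curvatureProfile a 0 = 0 := by
  simp [curvatureProfile, sinCosh, cosSinh]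

theorem valueProfile_one {a : ℝ} (ha : 0 < a) : valueProfile a 1 = 1 := by
  have hD := (sinCosh_sq_add_cosSinh_sq_pos ha).ne'
  rw [valueProfile, mul_one, div_eq_one_iff_eq hD]
  ring

theorem curvatureProfile_one (a : ℝ) : curvatureProfile a 1 = 0 := by
  rw [curvatureProfile, mul_one, mul_comm, sub_self, zero_div]

theorem isSolution_boundaryLift {M : ℝ} (hM : 0 < M) (A B C D : ℝ) :
    IsSolution M 0 (fun _ _ => 0) 0 A B C D (boundaryLift (freq M) A B C D) := by
  set a := freq M with ha
  have ha0 : 0 < a := freq_pos hM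
  have hMa : 4 * a ^ 4 = M := four_mul_freq_pow hM.le
  have V := hasDerivAt_valueProfile a
  have K := hasDerivAt_curvatureProfile a
  have V' := hasDerivAt_valueSlope ha0
  have K' := hasDerivAt_curvatureSlope ha0
  rw [hMa] at V'
  set w := boundaryLift a A B C D with hw
  let w₁ : ℝ → ℝ := fun x => A * -valueSlope a (1 - x) + B * valueSlope a x -
    C * -curvatureSlope a (1 - x) - D * curvatureSlope a x
  let w₂ : ℝ → ℝ := fun x => A * (M * curvatureProfile a (1 - x)) +
    B * (M * curvatureProfile a x) + C * valueProfile a (1 - x) + D * valueProfile a x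
  let w₃ : ℝ → ℝ := fun x => A * (M * -curvatureSlope a (1 - x)) +
    B * (M * curvatureSlope a x) + C * -valueSlope a (1 - x) + D * valueSlope a x
  have d0 : deriv w = w₁ := funext fun x =>
    (((((hasDerivAt_reflect V x).const_mul A).add ((V x).const_mul B)).sub
      ((hasDerivAt_reflect K x).const_mul C)).sub ((K x).const_mul D)).deriv
  have d1 : deriv w₁ = w₂ := funext fun x => by
    refine HasDerivAt.deriv ((((((hasDerivAt_reflect V' x).neg.const_mul A).add
      ((V' x).const_mul B)).sub ((hasDerivAt_reflect K' x).neg.const_mul C)).sub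
      ((K' x).const_mul D)).congr_deriv ?_)
    simp only [w₂]
    ring
  have d2 : deriv w₂ = w₃ := funext fun x =>
    ((((((hasDerivAt_reflect K x).const_mul M).const_mul A).add
      (((K x).const_mul M).const_mul B)).add
      ((hasDerivAt_reflect V x).const_mul C)).add ((V x).const_mul D)).deriv
  have d3 : deriv w₃ = fun x => -(M * w x) := funext fun x => by
    refine HasDerivAt.deriv (((((((hasDerivAt_reflect K' x).neg.const_mul M).const_mul A).add
      (((K' x).const_mul M).const_mul B)).add
      ((hasDerivAt_reflect V' x).neg.const_mul C)).add ((V' x).const_mul D)).congr_deriv ?_)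
    simp only [hw, boundaryLift]
    ring
  have hwc : ContDiff ℝ 4 w := by
    have h1 := contDiff_valueProfile a
    have h2 := contDiff_curvatureProfile a
    rw [hw]
    unfold boundaryLift
    fun_prop
  have hi2 : iteratedDeriv 2 w = w₂ := by
    rw [iteratedDeriv_succ', iteratedDeriv_succ', iteratedDeriv_zero, d0, d1]
  have hi4 : iteratedDeriv 4 w = fun x => -(M * w x) := by
    rw [iteratedDeriv_succ', iteratedDeriv_succ', iteratedDeriv_succ', iteratedDeriv_succ',
      iteratedDeriv_zero, d0, d1, d2, d3]
  have hI (n : ℕ) (hn : n ≤ 4) (x : ℝ) (hx : x ∈ Icc (0 : ℝ) 1) :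
      iteratedDerivWithin n w (Icc 0 1) x = iteratedDeriv n w x :=
    iteratedDerivWithin_eq_iteratedDeriv (uniqueDiffOn_Icc zero_lt_one)
      (hwc.contDiffAt.of_le (by exact_mod_cast hn)) hx
  have z0 := valueProfile_zero a
  have z1 := valueProfile_one ha0
  have z2 := curvatureProfile_zero a
  have z3 := curvatureProfile_one a
  refine ⟨hwc.contDiffOn, fun x hx => ?_, ?_, ?_, ?_, ?_⟩
  · rw [hI 4 le_rfl x (Ioo_subset_Icc_self hx), hi4]
    simp
  · simp [hw, boundaryLift, z0, z1, z2, z3]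
  · simp [hw, boundaryLift, z0, z1, z2, z3]
  · rw [hI 2 (by norm_num) 0 (by simp), hi2]
    simp [w₂, z0, z1, z2, z3]
  · rw [hI 2 (by norm_num) 1 (by simp), hi2]
    simp [w₂, z0, z1, z2, z3]

/-! ### The local problem -/

theorem isSolution_lift_add_potential {M : ℝ} (hM : 0 < M) {q : ℝ → ℝ}
    (hq : ContinuousOn q (Icc 0 1)) (A B C D : ℝ) :
    IsSolution M 0 (fun _ _ => 0) q A B C D
      (boundaryLift (freq M) A B C D + potential M q) := by
  simpa using (isSolution_boundaryLift hM A B C D).add continuousOn_const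
    (isSolution_potential hM hq)

theorem IsSolution.eqOn_lift_add_potential {M A B C D : ℝ} {q y : ℝ → ℝ} (hM : 0 < M)
    (hq : ContinuousOn q (Icc 0 1)) (h : IsSolution M 0 (fun _ _ => 0) q A B C D y) :
    EqOn y (boundaryLift (freq M) A B C D + potential M q) (Icc 0 1) := by
  have h1 := h.add continuousOn_const (isSolution_lift_add_potential hM hq A B C D).neg
  simp only [add_neg_cancel] at h1
  intro x hx
  have := h1.eqOn_zero hM hx
  simp only [Pi.add_apply, Pi.neg_apply, Pi.zero_apply] at this ⊢
  linarith

/-! ### The nonlocal term -/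

section Nonlocal

variable {M N : ℝ} {k : ℝ → ℝ → ℝ}

theorem abs_le_supNorm (hk : ContinuousOn (fun q : ℝ × ℝ => k q.1 q.2) (Icc 0 1 ×ˢ Icc 0 1))
    {x t : ℝ} (hx : x ∈ Icc (0 : ℝ) 1) (ht : t ∈ Icc (0 : ℝ) 1) : |k x t| ≤ supNorm k :=
  le_csSup ((isCompact_Icc.prod isCompact_Icc).image_of_continuousOn hk.abs).bddAbove
    ⟨(x, t), ⟨hx, ht⟩, rfl⟩

theorem supNorm_nonneg (k : ℝ → ℝ → ℝ) : 0 ≤ supNorm k := by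
  refine Real.sSup_nonneg ?_
  rintro _ ⟨q, -, rfl⟩
  exact abs_nonneg _

theorem continuousOn_nonlocal
    (hk : ContinuousOn (fun q : ℝ × ℝ => k q.1 q.2) (Icc 0 1 ×ˢ Icc 0 1)) {y : ℝ → ℝ}
    (hy : ContinuousOn y (Icc 0 1)) :
    ContinuousOn (fun x => ∫ t in (0 : ℝ)..1, k x t * y t) (Icc 0 1) := by
  -- Composing with the projection onto `[0,1]` gives a globally continuous integrand that agrees
  -- with the original one on the square.
  let π : ℝ → ℝ := fun x => projIcc 0 1 zero_le_one x
  have hπ : Continuous π := continuous_subtype_val.comp continuous_projIcc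
  have hπm (x : ℝ) : π x ∈ Icc (0 : ℝ) 1 := (projIcc 0 1 zero_le_one x).2
  have hπe {x : ℝ} (hx : x ∈ Icc (0 : ℝ) 1) : π x = x := by simp [π, projIcc_of_mem _ hx]
  have h1 : Continuous fun q : ℝ × ℝ => k (π q.1) (π q.2) :=
    hk.comp_continuous (f := fun q : ℝ × ℝ => (π q.1, π q.2)) (by fun_prop)
      fun q => ⟨hπm _, hπm _⟩
  have h2 : Continuous fun t => y (π t) := hy.comp_continuous hπ hπm
  have h3 : Continuous fun x => ∫ t in (0 : ℝ)..1, k (π x) (π t) * y (π t) :=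
    intervalIntegral.continuous_parametric_intervalIntegral_of_continuous'
      (h1.mul (h2.comp continuous_snd)) 0 1
  refine h3.continuousOn.congr fun x hx => intervalIntegral.integral_congr fun t ht => ?_
  rw [uIcc_of_le zero_le_one] at ht
  simp only [hπe hx, hπe ht]

theorem abs_nonlocal_le (hk : ContinuousOn (fun q : ℝ × ℝ => k q.1 q.2) (Icc 0 1 ×ˢ Icc 0 1))
    {y : ℝ → ℝ} {c : ℝ} (hy : ∀ t ∈ Icc (0 : ℝ) 1, |y t| ≤ c) {x : ℝ}
    (hx : x ∈ Icc (0 : ℝ) 1) : |∫ t in (0 : ℝ)..1, k x t * y t| ≤ supNorm k * c := by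
  have := intervalIntegral.norm_integral_le_of_norm_le_const (a := (0 : ℝ)) (b := 1)
    (f := fun t => k x t * y t) (C := supNorm k * c) fun t ht => by
      rw [uIoc_of_le zero_le_one] at ht
      have ht := Ioc_subset_Icc_self ht
      rw [Real.norm_eq_abs, abs_mul]
      exact mul_le_mul (abs_le_supNorm hk hx ht) (hy t ht) (abs_nonneg _) (supNorm_nonneg k)
  simpa using this

theorem nonlocal_ge (hk : ContinuousOn (fun q : ℝ × ℝ => k q.1 q.2) (Icc 0 1 ×ˢ Icc 0 1))
    (hNk : ∀ x ∈ Icc (0 : ℝ) 1, ∀ t ∈ Icc (0 : ℝ) 1, 0 ≤ N * k x t)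
    {y : ℝ → ℝ} (hyc : ContinuousOn y (Icc 0 1)) {c : ℝ} (hc : 0 ≤ c)
    (hy : ∀ t ∈ Icc (0 : ℝ) 1, -c ≤ y t) {x : ℝ} (hx : x ∈ Icc (0 : ℝ) 1) :
    -(|N| * supNorm k * c) ≤ N * ∫ t in (0 : ℝ)..1, k x t * y t := by
  have hkx : ContinuousOn (k x) (Icc 0 1) :=
    hk.comp (f := fun t => (x, t)) (by fun_prop) fun t ht => ⟨hx, ht⟩
  rw [← intervalIntegral.integral_const_mul]
  have h1 : ∫ t in (0 : ℝ)..1, -(|N| * supNorm k * c) ≤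
      ∫ t in (0 : ℝ)..1, N * (k x t * y t) := by
    refine intervalIntegral.integral_mono_on zero_le_one (by simp)
      (ContinuousOn.intervalIntegrable
        (by rw [uIcc_of_le zero_le_one]; exact (hkx.mul hyc).const_mul N))
      fun t ht => ?_
    have h2 : N * k x t ≤ |N| * supNorm k := by
      refine (le_abs_self _).trans ?_
      rw [abs_mul]
      exact mul_le_mul_of_nonneg_left (abs_le_supNorm hk hx ht) (abs_nonneg N)
    have h3 := mul_le_mul_of_nonneg_left (hy t ht) (hNk x hx t ht)
    have h4 := mul_le_mul_of_nonneg_right h2 hc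
    linarith
  simpa using h1

/-- A negative minimum would reproduce itself through the integral equation with a factor less than
`1`. -/
theorem IsSolution.nonneg (hM : 0 < M) (hM₁ : M < c₁)
    (hk : ContinuousOn (fun q : ℝ × ℝ => k q.1 q.2) (Icc 0 1 ×ˢ Icc 0 1))
    (hNk : ∀ x ∈ Icc (0 : ℝ) 1, ∀ t ∈ Icc (0 : ℝ) 1, 0 ≤ N * k x t)
    (hsmall : supNorm k * (|N| * greenMax M) < 1) {p : ℝ → ℝ}
    (hp : ContinuousOn p (Icc 0 1)) {A B C D : ℝ} (hp0 : ∀ x ∈ Icc (0 : ℝ) 1, 0 ≤ p x)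
    (hA : 0 ≤ A) (hB : 0 ≤ B) (hC : C ≤ 0) (hD : D ≤ 0) {y : ℝ → ℝ}
    (h : IsSolution M N k p A B C D y) : ∀ x ∈ Icc (0 : ℝ) 1, 0 ≤ y x := by
  have hyc := h.contDiffOn.continuousOn
  have hqc : ContinuousOn (fun x => p x + N * ∫ t in (0 : ℝ)..1, k x t * y t) (Icc 0 1) :=
    hp.add ((continuousOn_nonlocal hk hyc).const_mul N)
  have hrep := (IsSolution.local_iff.2 h).eqOn_lift_add_potential hM hqc
  obtain ⟨x₀, hx₀, hmin⟩ := isCompact_Icc.exists_isMinOn ⟨0, by simp⟩ hyc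
  have hmin (x : ℝ) (hx : x ∈ Icc (0 : ℝ) 1) : y x₀ ≤ y x := hmin hx
  intro x hx
  refine le_trans ?_ (hmin x hx)
  by_contra! hneg
  have hq (s : ℝ) (hs : s ∈ Icc (0 : ℝ) 1) : -(|N| * supNorm k * (-y x₀)) ≤
      p s + N * ∫ t in (0 : ℝ)..1, k s t * y t := by
    have := nonlocal_ge hk hNk hyc (c := -y x₀) (by linarith)
      (fun t ht => by linarith [hmin t ht]) hs
    linarith [hp0 s hs]
  have h1 := potential_ge hM hM₁ hqc
    (mul_nonneg (mul_nonneg (abs_nonneg N) (supNorm_nonneg k)) (neg_nonneg.2 hneg.le)) hq hx₀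
  have h2 := boundaryLift_nonneg (freq_pos hM) (freq_lt hM.le hM₁) hA hB hC hD hx₀
  have h3 := hrep hx₀
  simp only [Pi.add_apply] at h3
  -- With `c = -y x₀ > 0` and `ρ` the left side of `hsmall`, this is `ρc < c`, whereas `h1`, `h2`
  -- and `h3` give `-c = y x₀ ≥ -ρc`.
  have h4 := mul_lt_mul_of_pos_right hsmall (neg_pos.2 hneg)
  linarith

/-- Banach's fixed point theorem on `C[0,1]` for the map sending `f` to the solution of the local
problem with right-hand side `p + N ∫ k f`. -/
theorem exists_isSolution (hM : 0 < M) (hM₁ : M < c₁)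
    (hk : ContinuousOn (fun q : ℝ × ℝ => k q.1 q.2) (Icc 0 1 ×ˢ Icc 0 1))
    (hsmall : supNorm k * (|N| * greenMax M) < 1) {p : ℝ → ℝ}
    (hp : ContinuousOn p (Icc 0 1)) (A B C D : ℝ) : ∃ y, IsSolution M N k p A B C D y := by
  let I := Icc (0 : ℝ) 1
  let ext : C(I, ℝ) → ℝ → ℝ := fun f => IccExtend zero_le_one f
  have hext (f : C(I, ℝ)) : ContinuousOn (ext f) (Icc 0 1) :=
    f.continuous.Icc_extend'.continuousOn
  let q : C(I, ℝ) → ℝ → ℝ := fun f x => p x + N * ∫ t in (0 : ℝ)..1, k x t * ext f t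
  have hq (f : C(I, ℝ)) : ContinuousOn (q f) (Icc 0 1) :=
    hp.add ((continuousOn_nonlocal hk (hext f)).const_mul N)
  let w : C(I, ℝ) → ℝ → ℝ := fun f => boundaryLift (freq M) A B C D + potential M (q f)
  have hw (f : C(I, ℝ)) := isSolution_lift_add_potential hM (hq f) A B C D
  let T : C(I, ℝ) → C(I, ℝ) := fun f =>
    ⟨(Icc 0 1).domRestrict (w f), continuousOn_iff_continuous_domRestrict.1
      (hw f).contDiffOn.continuousOn⟩
  set ρ := supNorm k * (|N| * greenMax M) with hρ
  have hρ0 : 0 ≤ ρ :=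
    mul_nonneg (supNorm_nonneg k) (mul_nonneg (abs_nonneg N) (greenMax_nonneg hM hM₁))
  have hT : ContractingWith ⟨ρ, hρ0⟩ T := by
    refine ⟨by exact_mod_cast hsmall, LipschitzWith.of_dist_le_mul fun f g => ?_⟩
    rw [ContinuousMap.dist_le (by positivity)]
    intro x
    have hd (t : ℝ) (_ : t ∈ Icc (0 : ℝ) 1) : |ext f t - ext g t| ≤ dist f g :=
      ContinuousMap.dist_apply_le_dist (f := f) (g := g) (projIcc 0 1 zero_le_one t)
    have hb (s : ℝ) (hs : s ∈ Icc (0 : ℝ) 1) :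
        |q f s - q g s| ≤ |N| * (supNorm k * dist f g) := by
      have hks : ContinuousOn (k s) (Icc 0 1) :=
        hk.comp (f := fun t => (s, t)) (by fun_prop) fun t ht => ⟨hs, ht⟩
      have hi (f : C(I, ℝ)) :
          IntervalIntegrable (fun t => k s t * ext f t) MeasureTheory.volume 0 1 :=
        ContinuousOn.intervalIntegrable
          (by rw [uIcc_of_le zero_le_one]; exact hks.mul (hext f))
      have he : q f s - q g s = N * ∫ t in (0 : ℝ)..1, k s t * (ext f t - ext g t) := by
        simp only [q, mul_sub]
        rw [intervalIntegral.integral_sub (hi f) (hi g)]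
        ring
      rw [he, abs_mul]
      exact mul_le_mul_of_nonneg_left (abs_nonlocal_le hk hd hs) (abs_nonneg N)
    have h1 := abs_potential_le hM hM₁ ((hq f).sub (hq g))
      (mul_nonneg (abs_nonneg N) (mul_nonneg (supNorm_nonneg k) dist_nonneg)) hb x.2
    have h2 := potential_sub M x (hq f) (hq g)
    have h3 : dist (T f x) (T g x) = |potential M (q f) x - potential M (q g) x| := by
      change |(boundaryLift (freq M) A B C D x + potential M (q f) x) -
        (boundaryLift (freq M) A B C D x + potential M (q g) x)| = _
      rw [add_sub_add_left_eq_sub]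
    rw [h3, ← h2]
    refine h1.trans_eq ?_
    change _ = ρ * dist f g
    rw [hρ]
    ring
  set f := hT.fixedPoint with hf
  have hfix : T f = f := hT.fixedPoint_isFixedPt
  -- On `[0,1]` the fixed point equals `w f`, a local solution by construction, so it inherits the
  -- `C⁴` regularity and the boundary values.
  refine ⟨ext f, IsSolution.local_iff.1 ((hw f).congr fun x hx => ?_)⟩
  change IccExtend zero_le_one f x = w f x
  rw [IccExtend_of_mem _ _ hx]
  exact (DFunLike.congr_fun hfix ⟨x, hx⟩).symm

theorem IsSolution.nonpos (hM : 0 < M) (hM₁ : M < c₁)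
    (hk : ContinuousOn (fun q : ℝ × ℝ => k q.1 q.2) (Icc 0 1 ×ˢ Icc 0 1))
    (hNk : ∀ x ∈ Icc (0 : ℝ) 1, ∀ t ∈ Icc (0 : ℝ) 1, 0 ≤ N * k x t)
    (hsmall : supNorm k * (|N| * greenMax M) < 1) {p : ℝ → ℝ}
    (hp : ContinuousOn p (Icc 0 1)) {A B C D : ℝ} (hp0 : ∀ x ∈ Icc (0 : ℝ) 1, p x ≤ 0)
    (hA : A ≤ 0) (hB : B ≤ 0) (hC : 0 ≤ C) (hD : 0 ≤ D) {y : ℝ → ℝ}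
    (h : IsSolution M N k p A B C D y) : ∀ x ∈ Icc (0 : ℝ) 1, y x ≤ 0 := fun x hx =>
  neg_nonneg.1 <| h.neg.nonneg hM hM₁ hk hNk hsmall hp.neg (fun x hx => neg_nonneg.2 (hp0 x hx))
    (neg_nonneg.2 hA) (neg_nonneg.2 hB) (neg_nonpos.2 hC) (neg_nonpos.2 hD) x hx

/-- The difference of two solutions has zero data, so it is both nonnegative and nonpositive. -/
theorem hasUniqueSolution (hM : 0 < M) (hM₁ : M < c₁)
    (hk : ContinuousOn (fun q : ℝ × ℝ => k q.1 q.2) (Icc 0 1 ×ˢ Icc 0 1))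
    (hNk : ∀ x ∈ Icc (0 : ℝ) 1, ∀ t ∈ Icc (0 : ℝ) 1, 0 ≤ N * k x t)
    (hsmall : supNorm k * (|N| * greenMax M) < 1) {p : ℝ → ℝ}
    (hp : ContinuousOn p (Icc 0 1)) (A B C D : ℝ) : HasUniqueSolution M N k p A B C D := by
  obtain ⟨y, hy⟩ := exists_isSolution hM hM₁ hk hsmall hp A B C D
  refine ⟨y, hy, fun z hz x hx => ?_⟩
  have h := hz.add hk hy.neg
  simp only [add_neg_cancel] at h
  have h1 := h.nonneg hM hM₁ hk hNk hsmall continuousOn_const (fun _ _ => le_rfl) le_rfl le_rfl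
    le_rfl le_rfl x hx
  have h2 := h.nonpos hM hM₁ hk hNk hsmall continuousOn_const (fun _ _ => le_rfl) le_rfl le_rfl
    le_rfl le_rfl x hx
  simp only [Pi.add_apply, Pi.neg_apply] at h1 h2
  linarith

end Nonlocal

end

end NavierBVP

/-- The smallness condition is stated as a product, so that `N = 0` imposes no restriction and no
division by zero occurs. The sign claims concern every solution, which by uniqueness means the one
on `[0,1]`. -/
theorem theorem2p2 (M N : ℝ) (k : ℝ → ℝ → ℝ)
    (hM₀ : 0 < M) (hM₁ : M < c₁)
    (hk : ContinuousOn (fun q : ℝ × ℝ => k q.1 q.2) (Icc 0 1 ×ˢ Icc 0 1))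
    (hNk : ∀ x ∈ Icc (0 : ℝ) 1, ∀ t ∈ Icc (0 : ℝ) 1, 0 ≤ N * k x t)
    (hsmall : supNorm k * (|N| * greenMax M) < 1) :
    -- the inhomogeneous problem
    (∀ p : ℝ → ℝ, ContinuousOn p (Icc 0 1) → ∀ A B C D : ℝ,
      HasUniqueSolution M N k p A B C D ∧
      ((∀ x ∈ Icc (0 : ℝ) 1, 0 ≤ p x) → 0 ≤ A → 0 ≤ B → C ≤ 0 → D ≤ 0 →
        ∀ y, IsSolution M N k p A B C D y → ∀ x ∈ Icc (0 : ℝ) 1, 0 ≤ y x) ∧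
      ((∀ x ∈ Icc (0 : ℝ) 1, p x ≤ 0) → A ≤ 0 → B ≤ 0 → 0 ≤ C → 0 ≤ D →
        ∀ y, IsSolution M N k p A B C D y → ∀ x ∈ Icc (0 : ℝ) 1, y x ≤ 0)) ∧
    -- the homogeneous problem
    (∀ p : ℝ → ℝ, ContinuousOn p (Icc 0 1) →
      HasUniqueSolution M N k p 0 0 0 0 ∧
      ((∀ x ∈ Icc (0 : ℝ) 1, 0 ≤ p x) →
        ∀ y, IsSolution M N k p 0 0 0 0 y → ∀ x ∈ Icc (0 : ℝ) 1, 0 ≤ y x) ∧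
      ((∀ x ∈ Icc (0 : ℝ) 1, p x ≤ 0) →
        ∀ y, IsSolution M N k p 0 0 0 0 y → ∀ x ∈ Icc (0 : ℝ) 1, y x ≤ 0)) := by
  exact ⟨fun p hp A B C D => ⟨hasUniqueSolution hM₀ hM₁ hk hNk hsmall hp A B C D,
      fun hp0 hA hB hC hD y hy => hy.nonneg hM₀ hM₁ hk hNk hsmall hp hp0 hA hB hC hD,
      fun hp0 hA hB hC hD y hy => hy.nonpos hM₀ hM₁ hk hNk hsmall hp hp0 hA hB hC hD⟩,
    fun p hp => ⟨hasUniqueSolution hM₀ hM₁ hk hNk hsmall hp 0 0 0 0,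
      fun hp0 y hy =>
        hy.nonneg hM₀ hM₁ hk hNk hsmall hp hp0 le_rfl le_rfl le_rfl le_rfl,
      fun hp0 y hy =>
        hy.nonpos hM₀ hM₁ hk hNk hsmall hp hp0 le_rfl le_rfl le_rfl le_rfl⟩⟩
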